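/- Let $\Bbbk$ be a field and let $H$ be a finite-dimensional Hopf algebra over $\Bbbk$ with multiplication $m$, unit $u$, comultiplication $\Delta$, counit $\varepsilon$ and (automatically bijective) antipode $S$. For $n\ge 1$ let $m_n:H^{\otimes n}\to H$, $h_1\otimes\cdots\otimes h_n\mapsto h_1\cdots h_n$, and $\Delta_n:H\to H^{\otimes n}$, $h\mapsto\sum h_{(1)}\otimes\cdots\otimes h_{(n)}$, be the iterated multiplication and comultiplication. For any Hopf algebra with bijective antipode put $$\exp(H):=\min\{n\ge 1\mid m_n\circ(\mathrm{id}\otimes S^{-2}\otimes\cdots\otimes S^{-2n+2})\circ\Delta_n=u\circ\varepsilon\},$$ and for $i\in\mathbb Z$ put $$\exp_{2i}(H):=\min\{n\ge 1\mid m_n\circ(\mathrm{id}\otimes S^{2i}\otimes\cdots\otimes S^{2(n-1)i})\circ\Delta_n=u\circ\varepsilon\},$$ where $\min\varnothing=\infty$. Let $\langle S^2\rangle$ be the group generated by $S^2$ under composition, and let $H\rtimes\Bbbk\langle S^2\rangle$ be the Hopf algebra which is $H\otimes\Bbbk\langle S^2\rangle$ as a coalgebra, has multiplication $(h\rtimes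 S^{2i})(h'\rtimes S^{2j})=hS^{2i}(h')\rtimes S^{2(i+j)}$, unit $1\rtimes\mathrm{id}$ and antipode $h\rtimes S^{2i}\mapsto S^{-2i+1}(h)\rtimes S^{-2i}$; its antipode is bijective. Then $$\exp(H\rtimes\Bbbk\langle S^2\rangle)=\mathrm{lcm}\big(\exp_{2i}(H)\mid i\in\mathbb Z\big),$$ where the least common multiple of a family in $\{1,2,3,\dots\}\cup\{\infty\}$ is its least nonzero common multiple, every positive integer being a divisor of $\infty$ and $\infty$ dividing no positive integer (so both sides may be $\infty$). -/

import Mathlib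

noncomputable section

open TensorProduct Coalgebra HopfAlgebra WithConv

namespace HopfExp

/-! ### The antipode of a finite-dimensional Hopf algebra is bijective

The inverse powers of the antipode occur in the definitions below, so bijectivity is proved first:
`trInt p` is a right integral in the dual of `H`, and some `trInt p` is nonzero. -/

section Antipode
variable {k H : Type*} [Field k] [Ring H] [HopfAlgebra k H]

/-- `x ↦ x ⊗ 1`. -/
def inl (k H : Type*) [Field k] [Ring H] [HopfAlgebra k H] : H →ₗ[k] H ⊗[k] H :=
  (Algebra.TensorProduct.includeLeft : H →ₐ[k] H ⊗[k] H).toLinearMap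

/-- `x ↦ 1 ⊗ x`. -/
def inr (k H : Type*) [Field k] [Ring H] [HopfAlgebra k H] : H →ₗ[k] H ⊗[k] H :=
  (Algebra.TensorProduct.includeRight : H →ₐ[k] H ⊗[k] H).toLinearMap

lemma algHom_comp_one {B : Type*} [Ring B] [Algebra k B] (f : H →ₐ[k] B) :
    toConv (f.toLinearMap ∘ₗ (1 : WithConv (H →ₗ[k] H)).ofConv) = 1 := by
  ext x; simp [LinearMap.convOne_def]

lemma comp_antipode_mul {B : Type*} [Ring B] [Algebra k B] (f : H →ₐ[k] B) :
    toConv (f.toLinearMap ∘ₗ antipode k) * toConv f.toLinearMap = 1 := by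
  rw [← algHom_comp_one f, ← LinearMap.antipode_mul_id, LinearMap.algHom_comp_convMul_distrib]
  rfl

lemma mul_comp_antipode {B : Type*} [Ring B] [Algebra k B] (f : H →ₐ[k] B) :
    toConv f.toLinearMap * toConv (f.toLinearMap ∘ₗ antipode k) = 1 := by
  rw [← algHom_comp_one f, ← LinearMap.id_mul_antipode, LinearMap.algHom_comp_convMul_distrib]
  rfl

lemma inl_mul_inr : toConv (inl k H) * toConv (inr k H) = toConv comul := by
  have : LinearMap.mul' k (H ⊗[k] H) ∘ₗ TensorProduct.map (inl k H) (inr k H) = LinearMap.id := by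
    ext x y; simp [inl, inr]
  ext x
  exact LinearMap.congr_fun this (comul x)

lemma comul_antipode_mul_inl :
    toConv (comul ∘ₗ antipode k) * toConv (inl k H) = toConv (inr k H ∘ₗ antipode k) := by
  have h1 : toConv (comul ∘ₗ antipode k) * toConv (comul : H →ₗ[k] H ⊗[k] H) = 1 :=
    comp_antipode_mul (Bialgebra.comulAlgHom k H)
  have h2 : toConv (inr k H) * toConv (inr k H ∘ₗ antipode k) = 1 := mul_comp_antipode _
  rw [← inl_mul_inr] at h1
  calc _ = toConv (comul ∘ₗ antipode k) * toConv (inl k H) *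
        (toConv (inr k H) * toConv (inr k H ∘ₗ antipode k)) := by rw [h2, mul_one]
    _ = _ := by rw [← mul_assoc, mul_assoc _ (toConv (inl k H)), h1, one_mul]

lemma inr_mul_comul_antipode :
    toConv (inr k H) * toConv (comul ∘ₗ antipode k) = toConv (inl k H ∘ₗ antipode k) := by
  have h1 : toConv (comul : H →ₗ[k] H ⊗[k] H) * toConv (comul ∘ₗ antipode k) = 1 :=
    mul_comp_antipode (Bialgebra.comulAlgHom k H)
  have h2 : toConv (inl k H ∘ₗ antipode k) * toConv (inl k H) = 1 := comp_antipode_mul _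
  rw [← inl_mul_inr] at h1
  calc _ = toConv (inl k H ∘ₗ antipode k) * toConv (inl k H) *
        (toConv (inr k H) * toConv (comul ∘ₗ antipode k)) := by rw [h2, one_mul]
    _ = _ := by rw [mul_assoc, ← mul_assoc (toConv (inl k H)), h1, mul_one]

/-- The antipode reverses the comultiplication. -/
lemma comul_comp_antipode : (comul ∘ₗ antipode k : H →ₗ[k] H ⊗[k] H) =
    (TensorProduct.map (antipode k) (antipode k)) ∘ₗ
      (TensorProduct.comm k H H).toLinearMap ∘ₗ comul := by
  have h : toConv (inr k H ∘ₗ antipode k) * toConv (inl k H ∘ₗ antipode k)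
      = toConv (comul ∘ₗ antipode k) := by
    have h2 : toConv (inl k H) * toConv (inl k H ∘ₗ antipode k) = 1 := mul_comp_antipode _
    rw [← comul_antipode_mul_inl, mul_assoc, h2, mul_one]
  have h' : LinearMap.mul' k (H ⊗[k] H) ∘ₗ
      TensorProduct.map (inr k H ∘ₗ antipode k) (inl k H ∘ₗ antipode k) =
      (TensorProduct.map (antipode k) (antipode k)) ∘ₗ (TensorProduct.comm k H H).toLinearMap := by
    ext x y; simp [inl, inr]
  rw [← LinearMap.comp_assoc, ← h', LinearMap.comp_assoc]
  exact (congrArg WithConv.ofConv h).symm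

/-- Contraction of the first tensor factor. -/
def ctl (g : H →ₗ[k] k) : H ⊗[k] H →ₗ[k] H := (TensorProduct.lid k H).toLinearMap ∘ₗ g.rTensor H
/-- Contraction of the second tensor factor. -/
def ctr (g : H →ₗ[k] k) : H ⊗[k] H →ₗ[k] H := (TensorProduct.rid k H).toLinearMap ∘ₗ g.lTensor H

@[simp] lemma ctl_tmul (g : H →ₗ[k] k) (x y : H) : ctl g (x ⊗ₜ y) = g x • y := by simp [ctl]
@[simp] lemma ctr_tmul (g : H →ₗ[k] k) (x y : H) : ctr g (x ⊗ₜ y) = g y • x := by simp [ctr]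

/-- `x ↦ g(x₁) x₂`. -/
def lhit (g : H →ₗ[k] k) : H →ₗ[k] H := ctl g ∘ₗ comul
/-- `x ↦ x₁ g(x₂)`. -/
def rhit (g : H →ₗ[k] k) : H →ₗ[k] H := ctr g ∘ₗ comul

lemma lhit_rhit (g p : H →ₗ[k] k) (x : H) : lhit g (rhit p x) = rhit p (lhit g x) := by
  let Φ : H ⊗[k] (H ⊗[k] H) →ₗ[k] H := ctl g ∘ₗ (ctr p).lTensor H
  have h1 : ctl g ∘ₗ comul ∘ₗ ctr p =
      Φ ∘ₗ (TensorProduct.assoc k H H H).toLinearMap ∘ₗ (comul : H →ₗ[k] H ⊗[k] H).rTensor H := by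
    ext a b
    simp only [Φ, AlgebraTensorModule.curry_apply, LinearMap.restrictScalars_self, curry_apply,
      LinearMap.coe_comp, Function.comp_apply, ctr_tmul, LinearMap.rTensor_tmul,
      LinearEquiv.coe_coe, map_smul]
    induction comul (R := k) a with
    | zero => simp
    | add u v hu hv => simp only [map_add, add_tmul, smul_add, hu, hv]
    | tmul u v => simp [smul_smul, mul_comm]
  have h2 : ctr p ∘ₗ comul ∘ₗ ctl g = Φ ∘ₗ (comul : H →ₗ[k] H ⊗[k] H).lTensor H := by
    ext a b
    simp only [Φ, AlgebraTensorModule.curry_apply, LinearMap.restrictScalars_self, curry_apply,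
      LinearMap.coe_comp, Function.comp_apply, ctl_tmul, LinearMap.lTensor_tmul, map_smul]
  have e1 := LinearMap.congr_fun h1 (comul x)
  have e2 := LinearMap.congr_fun h2 (comul x)
  have e3 := Coalgebra.coassoc_apply (R := k) x
  simp only [LinearMap.coe_comp, Function.comp_apply, LinearEquiv.coe_coe] at e1 e2
  rw [e3, ← e2] at e1
  exact e1

lemma lhit_lhit (f g : H →ₗ[k] k) (x : H) :
    lhit f (lhit g x) = lhit (LinearMap.mul' k k ∘ₗ TensorProduct.map g f ∘ₗ comul) x := by
  let Φ : H ⊗[k] (H ⊗[k] H) →ₗ[k] H := ctl g ∘ₗ (ctl f).lTensor H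
  have h1 : ctl (LinearMap.mul' k k ∘ₗ TensorProduct.map g f ∘ₗ comul) =
      Φ ∘ₗ (TensorProduct.assoc k H H H).toLinearMap ∘ₗ (comul : H →ₗ[k] H ⊗[k] H).rTensor H := by
    ext a b
    simp only [Φ, AlgebraTensorModule.curry_apply, LinearMap.restrictScalars_self, curry_apply,
      LinearMap.coe_comp, Function.comp_apply, ctl_tmul, LinearMap.rTensor_tmul,
      LinearEquiv.coe_coe]
    induction comul (R := k) a with
    | zero => simp
    | add u v hu hv => simp only [map_add, add_tmul, add_smul, hu, hv]
    | tmul u v => simp [smul_smul, mul_comm]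
  have h2 : ctl f ∘ₗ comul ∘ₗ ctl g = Φ ∘ₗ (comul : H →ₗ[k] H ⊗[k] H).lTensor H := by
    ext a b
    simp only [Φ, AlgebraTensorModule.curry_apply, LinearMap.restrictScalars_self, curry_apply,
      LinearMap.coe_comp, Function.comp_apply, ctl_tmul, LinearMap.lTensor_tmul, map_smul]
  have e1 := LinearMap.congr_fun h1 (comul x)
  have e2 := LinearMap.congr_fun h2 (comul x)
  have e3 := Coalgebra.coassoc_apply (R := k) x
  simp only [LinearMap.coe_comp, Function.comp_apply, LinearEquiv.coe_coe] at e1 e2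
  rw [e3, ← e2] at e1
  exact e1.symm

lemma trace_comp_comm (f g : H →ₗ[k] H) :
    LinearMap.trace k H (f ∘ₗ g) = LinearMap.trace k H (g ∘ₗ f) :=
  LinearMap.trace_mul_comm k f g

section Finite
variable {ι : Type*} [Fintype ι] (b : Module.Basis ι k H)

lemma sum_ctr_tmul (t : H ⊗[k] H) : ∑ a, ctr (b.coord a) t ⊗ₜ[k] b a = t := by
  induction t with
  | zero => simp
  | add u v hu hv => simp only [map_add, add_tmul, Finset.sum_add_distrib, hu, hv]
  | tmul u v =>
    simp only [ctr_tmul, smul_tmul, ← tmul_sum]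
    congr 1
    simp [b.sum_repr v]

lemma sum_rhit_tmul (x : H) : ∑ a, rhit (b.coord a) x ⊗ₜ[k] b a = comul x := sum_ctr_tmul b _

/-- The functional `x ↦ tr (y ↦ S(z₁) p(z₂))` with `z = x S(y)`. -/
def trInt (p : H →ₗ[k] k) : H →ₗ[k] k :=
  LinearMap.trace k H ∘ₗ
    (LinearMap.lcomp k H (antipode k)) ∘ₗ (LinearMap.llcomp k H H H (antipode k ∘ₗ rhit p)) ∘ₗ
      LinearMap.mul k H

lemma trInt_apply (p : H →ₗ[k] k) (x : H) : trInt p x =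
    LinearMap.trace k H (antipode k ∘ₗ rhit p ∘ₗ LinearMap.mulLeft k x ∘ₗ antipode k) := rfl

lemma mulLeft_lhit (g : H →ₗ[k] k) (x : H) :
    LinearMap.mulLeft k (lhit g x) ∘ₗ antipode k = ∑ a, lhit (g ∘ₗ LinearMap.mulRight k (b a)) ∘ₗ
      LinearMap.mulLeft k x ∘ₗ antipode k ∘ₗ rhit (b.coord a) := by
  ext y
  have h0 : ∀ (t : H ⊗[k] H) (c : H), ctl (g ∘ₗ LinearMap.mulRight k c) t = ctl g (t * (c ⊗ₜ 1)) := by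
    intro t c
    induction t with
    | zero => simp
    | add u v hu hv => simp only [map_add, add_mul, hu, hv]
    | tmul u v => simp
  have h1 : ∀ (t : H ⊗[k] H) (c : H), ctl g (t * (1 ⊗ₜ c)) = ctl g t * c := by
    intro t c
    induction t with
    | zero => simp
    | add u v hu hv => simp only [map_add, add_mul, hu, hv]
    | tmul u v => simp
  let Ψ : H ⊗[k] H →ₗ[k] H := ctl g ∘ₗ LinearMap.mulLeft k (comul x) ∘ₗ
    LinearMap.mul' k (H ⊗[k] H) ∘ₗ TensorProduct.map (comul ∘ₗ antipode k) (inl k H)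
  have h2 : Ψ (comul y) = ctl g (comul x * (1 ⊗ₜ antipode k y)) := by
    have := congrArg (fun f => f.ofConv y) (comul_antipode_mul_inl (k := k) (H := H))
    have h3 : (LinearMap.mul' k (H ⊗[k] H)) ((TensorProduct.map (comul ∘ₗ antipode k) (inl k H)) (comul y))
      = 1 ⊗ₜ antipode k y := this
    simp [Ψ, h3]
  rw [← sum_rhit_tmul b y, map_sum, h1] at h2
  simp only [LinearMap.coe_comp, Function.comp_apply, LinearMap.mulLeft_apply, LinearMap.sum_apply]
  rw [show lhit g x = ctl g (comul x) from rfl, ← h2]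
  refine Finset.sum_congr rfl fun a _ => ?_
  simp [Ψ, lhit, h0, inl, mul_assoc]

lemma sum_rhit_antipode_lhit (g : H →ₗ[k] k) (w : H) :
    ∑ a, rhit (b.coord a) (antipode k (lhit (g ∘ₗ LinearMap.mulRight k (b a)) w)) =
      g 1 • antipode k w := by
  let Ψ : H ⊗[k] H →ₗ[k] H := ctr g ∘ₗ
    LinearMap.mul' k (H ⊗[k] H) ∘ₗ TensorProduct.map (inr k H) (comul ∘ₗ antipode k)
  have h2 : Ψ (comul w) = g 1 • antipode k w := by
    have := congrArg (fun f => f.ofConv w) (inr_mul_comul_antipode (k := k) (H := H))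
    have h3 : (LinearMap.mul' k (H ⊗[k] H)) ((TensorProduct.map (inr k H) (comul ∘ₗ antipode k)) (comul w))
      = antipode k w ⊗ₜ 1 := this
    simp [Ψ, h3]
  rw [← h2]
  have h4 : ∀ (t : H ⊗[k] H) (u : H), ∑ a, g (u * b a) • ctr (b.coord a) t =
      ctr g ((1 ⊗ₜ u) * t) := by
    intro t u
    conv_rhs => rw [← sum_ctr_tmul b t, Finset.mul_sum, map_sum]
    simp
  have h5 : Ψ = ∑ a, rhit (b.coord a) ∘ₗ antipode k ∘ₗ ctl (g ∘ₗ LinearMap.mulRight k (b a)) := by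
    ext u v
    simp [Ψ, inr, ← h4, rhit]
  rw [h5]
  simp [lhit]

variable [FiniteDimensional k H]

lemma trInt_lhit (p g : H →ₗ[k] k) (x : H) : trInt p (lhit g x) = g 1 * trInt p x := by
  let b := Module.finBasis k H
  have h1 : antipode k ∘ₗ rhit p ∘ₗ LinearMap.mulLeft k (lhit g x) ∘ₗ antipode k =
      ∑ a, ((antipode k ∘ₗ lhit (g ∘ₗ LinearMap.mulRight k (b a))) ∘ₗ (rhit p ∘ₗ
        LinearMap.mulLeft k x ∘ₗ antipode k)) ∘ₗ rhit (b.coord a) := by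
    rw [mulLeft_lhit b]
    ext y
    simp [lhit_rhit]
  have h2 : ∑ a, rhit (b.coord a) ∘ₗ antipode k ∘ₗ lhit (g ∘ₗ LinearMap.mulRight k (b a)) =
      g 1 • antipode k := by
    ext w
    simpa using sum_rhit_antipode_lhit b g w
  rw [trInt_apply, h1, map_sum]
  have h3 : ∀ a, LinearMap.trace k H (((antipode k ∘ₗ lhit (g ∘ₗ LinearMap.mulRight k (b a))) ∘ₗ
      (rhit p ∘ₗ LinearMap.mulLeft k x ∘ₗ antipode k)) ∘ₗ rhit (b.coord a)) =
      LinearMap.trace k H ((rhit (b.coord a) ∘ₗ antipode k ∘ₗ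
        lhit (g ∘ₗ LinearMap.mulRight k (b a))) ∘ₗ
        (rhit p ∘ₗ LinearMap.mulLeft k x ∘ₗ antipode k)) := fun a => by
    rw [trace_comp_comm]; rfl
  have h4 : ∑ a, (rhit (b.coord a) ∘ₗ antipode k ∘ₗ lhit (g ∘ₗ LinearMap.mulRight k (b a))) ∘ₗ
      (rhit p ∘ₗ LinearMap.mulLeft k x ∘ₗ antipode k) =
      (g 1 • antipode k) ∘ₗ (rhit p ∘ₗ LinearMap.mulLeft k x ∘ₗ antipode k) := by
    rw [← h2]; ext y; simp
  simp only [h3]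
  rw [← map_sum, h4, LinearMap.smul_comp, map_smul, smul_eq_mul, trInt_apply]

lemma exists_trInt_ne_zero : ∃ p : H →ₗ[k] k, trInt p ≠ 0 := by
  by_contra! hp
  let b := Module.finBasis k H
  have h1 : ∀ a, trInt (b.coord a) (antipode k (b a)) = LinearMap.trace k H
      (LinearMap.mulRight k (b a) ∘ₗ antipode k ∘ₗ rhit (b.coord a) ∘ₗ antipode k) := by
    intro a
    have : LinearMap.mulLeft k (antipode k (b a)) ∘ₗ antipode k =
        antipode k ∘ₗ LinearMap.mulRight k (b a) := by
      ext y; simp [antipode_mul_antidistrib]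
    rw [trInt_apply, this, trace_comp_comm (LinearMap.mulRight k (b a))]
    rfl
  have h2 : ∑ a, LinearMap.mulRight k (b a) ∘ₗ antipode k ∘ₗ rhit (b.coord a) ∘ₗ antipode k =
      (counit (R := k) (A := H)).smulRight (1 : H) := by
    ext y
    have := mul_antipode_rTensor_comul_apply (R := k) (antipode k y)
    rw [← sum_rhit_tmul b, counit_antipode] at this
    simpa [Algebra.algebraMap_eq_smul_one] using this
  have h3 : (0 : k) = 1 := by
    calc (0 : k) = ∑ a, trInt (b.coord a) (antipode k (b a)) := by simp [hp]
      _ = 1 := by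
        simp only [h1]
        rw [← map_sum, h2, LinearMap.trace_smulRight]
        simp
  exact zero_ne_one h3

lemma antipode_injective : Function.Injective (antipode k (A := H)) := by
  rw [injective_iff_map_eq_zero]
  intro h hh
  obtain ⟨p, hp⟩ := exists_trInt_ne_zero (k := k) (H := H)
  obtain ⟨x, hx⟩ : ∃ x, trInt p x ≠ 0 := by
    by_contra! h0
    exact hp (LinearMap.ext h0)
  set L := trInt p with hL
  let b := Module.finBasis k H
  -- `z₁ L(z₂) = L(z) 1`
  have hint : ∀ z, rhit L z = L z • 1 := by
    intro z
    refine (Module.forall_dual_apply_eq_zero_iff k _).1 ?_ |> sub_eq_zero.1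
    intro g
    have e : g (rhit L z) = L (lhit g z) := by
      simp only [rhit, lhit, LinearMap.comp_apply]
      induction comul (R := k) z with
      | zero => simp
      | add u v hu hv => simp only [map_add, hu, hv]
      | tmul u v => simp [mul_comm]
    rw [map_sub, e, hL, trInt_lhit]
    simp [mul_comm]
  have h1 : ∀ (t : H ⊗[k] H) (c : H), ctr L (t * (c ⊗ₜ 1)) = ctr L t * c := by
    intro t c
    induction t with
    | zero => simp
    | add u v hu hv => simp only [map_add, add_mul, hu, hv]
    | tmul u v => simp
  have hE : ∀ y, lhit (L ∘ₗ LinearMap.mulLeft k y ∘ₗ antipode k) h = 0 := by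
    intro y
    let Ψ : H ⊗[k] H →ₗ[k] H := ctr L ∘ₗ LinearMap.mulLeft k (comul y) ∘ₗ
      LinearMap.mul' k (H ⊗[k] H) ∘ₗ TensorProduct.map (comul ∘ₗ antipode k) (inl k H)
    have h2 : Ψ (comul h) = 0 := by
      have := congrArg (fun f => f.ofConv h) (comul_antipode_mul_inl (k := k) (H := H))
      have h3 : (LinearMap.mul' k (H ⊗[k] H))
          ((TensorProduct.map (comul ∘ₗ antipode k) (inl k H)) (comul h))
        = 1 ⊗ₜ antipode k h := this
      simp [Ψ, h3, hh]
    have h3 : Ψ = ctl (L ∘ₗ LinearMap.mulLeft k y ∘ₗ antipode k) := by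
      ext u v
      have : ctr L (comul (y * antipode k u)) = L (y * antipode k u) • 1 := hint _
      simp [Ψ, inl, ← mul_assoc, h1, ← Bialgebra.comul_mul, this]
    rw [lhit, LinearMap.comp_apply, ← h3, h2]
  have h4 : ∑ a, lhit (b.coord a) (lhit (L ∘ₗ LinearMap.mulLeft k (x * antipode k (antipode k (b a)))
      ∘ₗ antipode k) h) = 0 := Finset.sum_eq_zero fun a _ => by rw [hE, map_zero]
  have h5 : ∑ a, LinearMap.mul' k k ∘ₗ TensorProduct.map
      (L ∘ₗ LinearMap.mulLeft k (x * antipode k (antipode k (b a))) ∘ₗ antipode k) (b.coord a) ∘ₗ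
      comul = L x • counit := by
    have h6 : ∀ t : H ⊗[k] H, ∑ a, LinearMap.mul' k k (TensorProduct.map
        (L ∘ₗ LinearMap.mulLeft k (x * antipode k (antipode k (b a))) ∘ₗ antipode k)
        (b.coord a) t) = L (x * antipode k (LinearMap.mul' k H ((antipode k).lTensor H t))) := by
      intro t
      conv_rhs => rw [← sum_ctr_tmul b t]
      simp only [map_sum, Finset.mul_sum]
      refine Finset.sum_congr rfl fun a _ => ?_
      induction t with
      | zero => simp
      | add u v hu hv => simp only [map_add, add_tmul, mul_add, hu, hv]
      | tmul u v => simp [antipode_mul_antidistrib, mul_comm]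
    ext y
    simp only [LinearMap.sum_apply, LinearMap.comp_apply, h6]
    simp [Algebra.algebraMap_eq_smul_one, mul_comm]
  have h7 : lhit (L x • (counit : H →ₗ[k] k)) h = L x • h := by
    have h8 : lhit (counit : H →ₗ[k] k) h = h := by
      simp [lhit, ctl]
    have h9 : ctl (L x • (counit : H →ₗ[k] k)) = L x • ctl (counit : H →ₗ[k] k) := by
      ext u v; simp [smul_smul]
    rw [lhit, LinearMap.comp_apply, h9, LinearMap.smul_apply]
    exact congrArg _ h8
  simp only [lhit_lhit] at h4
  rw [← h5] at h7
  have h10 : ∀ f : Fin (Module.finrank k H) → (H →ₗ[k] k), lhit (∑ a, f a) h = ∑ a, lhit (f a) h := by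
    intro f
    have : ctl (∑ a, f a) = ∑ a, ctl (f a) := by
      ext u v; simp [Finset.sum_smul]
    simp [lhit, this]
  rw [h10, h4] at h7
  exact (smul_eq_zero.1 h7.symm).resolve_left hx

/-- The antipode of a finite-dimensional Hopf algebra is bijective. -/
theorem antipode_bijective : Function.Bijective (antipode k (A := H)) :=
  ⟨antipode_injective, LinearMap.surjective_of_injective antipode_injective⟩

end Finite

end Antipode

/-! ### Hopf algebras with bijective antipode, and the square of the antipode -/

/-- The antipode of the Hopf algebra `H` is bijective. -/
class BijectiveAntipode (k H : Type*) [Field k] [Ring H] [HopfAlgebra k H] : Prop where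
  bijective : Function.Bijective (antipode k (A := H))

instance (k H : Type*) [Field k] [Ring H] [HopfAlgebra k H] [FiniteDimensional k H] :
    BijectiveAntipode k H := ⟨antipode_bijective⟩

/-- The square `S²` of the (bijective) antipode, as an algebra automorphism. -/
def antipodeSq (k H : Type*) [Field k] [Ring H] [HopfAlgebra k H] [BijectiveAntipode k H] :
    H ≃ₐ[k] H :=
  AlgEquiv.ofBijective
    (AlgHom.ofLinearMap (antipode k ∘ₗ antipode k) (by simp)
      (fun x y => by simp [antipode_mul_antidistrib]))
    (BijectiveAntipode.bijective.comp BijectiveAntipode.bijective)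

/-- The cyclic group `⟨S²⟩` generated by the square of the antipode. -/
abbrev AntipodeSqGroup (k H : Type*) [Field k] [Ring H] [HopfAlgebra k H]
    [BijectiveAntipode k H] : Subgroup (H ≃ₐ[k] H) :=
  Subgroup.zpowers (antipodeSq k H)

section Group
variable {k H : Type*} [Field k] [Ring H] [HopfAlgebra k H] [BijectiveAntipode k H]

@[simp] lemma antipodeSq_apply (x : H) : antipodeSq k H x = antipode k (antipode k x) := rfl

/-- The powers of `S²` are coalgebra maps. -/
lemma comul_group_counit_group (g : AntipodeSqGroup k H) :
    (∀ x, comul (R := k) (g.1 x) =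
      TensorProduct.map g.1.toLinearMap g.1.toLinearMap (comul x)) ∧
    (∀ x, counit (R := k) (g.1 x) = counit (R := k) x) := by
  let P : Subgroup (H ≃ₐ[k] H) :=
    { carrier := {f | (∀ x, comul (R := k) (f x) =
        TensorProduct.map f.toLinearMap f.toLinearMap (comul x)) ∧
        (∀ x, counit (R := k) (f x) = counit (R := k) x)}
      one_mem' := by
        refine ⟨fun x => ?_, fun x => rfl⟩
        have : TensorProduct.map (1 : H ≃ₐ[k] H).toLinearMap (1 : H ≃ₐ[k] H).toLinearMap =
            LinearMap.id := by ext; simp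
        rw [this]; rfl
      mul_mem' := by
        rintro f f' ⟨h1, h2⟩ ⟨h3, h4⟩
        refine ⟨fun x => ?_, fun x => ?_⟩
        · have : TensorProduct.map (f * f').toLinearMap (f * f').toLinearMap =
              TensorProduct.map f.toLinearMap f.toLinearMap ∘ₗ
                TensorProduct.map f'.toLinearMap f'.toLinearMap := by ext; simp
          rw [this, AlgEquiv.mul_apply, h1, h3]; rfl
        · rw [AlgEquiv.mul_apply, h2, h4]
      inv_mem' := by
        rintro f ⟨h1, h2⟩
        have hf : ∀ x, f (f⁻¹ x) = x := fun x => f.apply_symm_apply x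
        have hf' : ∀ x, f⁻¹ (f x) = x := fun x => f.symm_apply_apply x
        refine ⟨fun x => ?_, fun x => ?_⟩
        · have : TensorProduct.map f⁻¹.toLinearMap f⁻¹.toLinearMap ∘ₗ
              TensorProduct.map f.toLinearMap f.toLinearMap = LinearMap.id := by
            ext; simp [hf']
          conv_rhs => rw [← hf x, h1, ← LinearMap.comp_apply, this]
          rfl
        · conv_rhs => rw [← hf x, h2] }
  have hP : AntipodeSqGroup k H ≤ P := by
    rw [Subgroup.zpowers_le]
    have hc : ∀ x : H, comul (R := k) (antipode k x) = TensorProduct.map (antipode k) (antipode k)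
        (TensorProduct.comm k H H (comul x)) := fun x =>
      LinearMap.congr_fun comul_comp_antipode x
    refine ⟨fun x => ?_, fun x => by simp⟩
    rw [antipodeSq_apply, hc, hc]
    induction comul (R := k) x with
    | zero => simp
    | add u v hu hv => simp only [map_add, hu, hv]
    | tmul u v => simp
  exact hP g.2

end Group

/-! ### The semidirect product `H ⋊ k⟨S²⟩` -/

/-- The underlying space of the semidirect product `H ⋊ k⟨S²⟩`: the tensor product of `H` with
the group algebra of `⟨S²⟩`. -/
def SemidirectProduct (k H : Type*) [Field k] [Ring H] [HopfAlgebra k H]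
    [BijectiveAntipode k H] : Type _ :=
  H ⊗[k] MonoidAlgebra k (AntipodeSqGroup k H)

namespace SemidirectProduct

section
variable (k H : Type*) [Field k] [Ring H] [HopfAlgebra k H] [BijectiveAntipode k H]

instance : AddCommGroup (SemidirectProduct k H) :=
  inferInstanceAs (AddCommGroup (H ⊗[k] MonoidAlgebra k (AntipodeSqGroup k H)))

instance instModule : Module k (SemidirectProduct k H) :=
  inferInstanceAs (Module k (H ⊗[k] MonoidAlgebra k (AntipodeSqGroup k H)))

/-- As a coalgebra, `H ⋊ k⟨S²⟩` is the tensor product of the coalgebras `H` and `k⟨S²⟩`. -/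
instance instCoalgebra : Coalgebra k (SemidirectProduct k H) :=
  inferInstanceAs (Coalgebra k (H ⊗[k] MonoidAlgebra k (AntipodeSqGroup k H)))

end

section
variable {k H : Type*} [Field k] [Ring H] [HopfAlgebra k H] [BijectiveAntipode k H]

/-- The element `h ⋊ g`, for `g` in `⟨S²⟩`, as a linear function of `h`. -/
def mk (g : AntipodeSqGroup k H) : H →ₗ[k] SemidirectProduct k H :=
  (TensorProduct.mk k H (MonoidAlgebra k (AntipodeSqGroup k H))).flip (MonoidAlgebra.single g 1)

lemma induction {p : SemidirectProduct k H → Prop} (x : SemidirectProduct k H)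
    (h0 : p 0) (hadd : ∀ x y, p x → p y → p (x + y)) (hmk : ∀ g h, p (mk g h)) : p x := by
  refine TensorProduct.induction_on (motive := p) x h0 (fun h a => ?_) hadd
  refine MonoidAlgebra.induction_linear (motive := fun a => p (h ⊗ₜ[k] a)) a ?_ ?_ ?_
  · rw [tmul_zero]; exact h0
  · intro a b ha hb
    rw [tmul_add]; exact hadd _ _ ha hb
  · intro g r
    have : h ⊗ₜ[k] (MonoidAlgebra.single g r) = mk g (r • h) := by
      change _ = (r • h) ⊗ₜ[k] (MonoidAlgebra.single g 1)
      rw [smul_tmul]; simp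
    rw [this]; exact hmk g _

lemma hom_ext {M : Type*} [AddCommGroup M] [Module k M] {f f' : SemidirectProduct k H →ₗ[k] M}
    (h : ∀ g x, f (mk g x) = f' (mk g x)) : f = f' := by
  ext x
  induction x using induction with
  | h0 => simp
  | hadd x y hx hy => simp only [map_add, hx, hy]
  | hmk g x => exact h g x

/-- Left multiplication by the elements of `⟨S²⟩`: `g (k ⋊ g') = g(k) ⋊ g g'`. -/
def groupAct : AntipodeSqGroup k H →*
    Module.End k (H ⊗[k] MonoidAlgebra k (AntipodeSqGroup k H)) where
  toFun g := TensorProduct.map g.1.toLinearMap (LinearMap.mulLeft k (MonoidAlgebra.single g 1))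
  map_one' := by ext; simp
  map_mul' g g' := by ext; simp [mul_assoc]

/-- The multiplication, as a bilinear map: `h ⋊ a` acts as left multiplication by `h` after the
left action of `a`. -/
def mulBilin : SemidirectProduct k H →ₗ[k] SemidirectProduct k H →ₗ[k] SemidirectProduct k H :=
  TensorProduct.lift
    ((LinearMap.mul k (Module.End k (H ⊗[k] MonoidAlgebra k (AntipodeSqGroup k H)))).compl₁₂
      (LinearMap.rTensorHom (MonoidAlgebra k (AntipodeSqGroup k H)) ∘ₗ LinearMap.mul k H)
      (MonoidAlgebra.lift k _ _ groupAct).toLinearMap)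

lemma mulBilin_mk (g g' : AntipodeSqGroup k H) (x y : H) :
    mulBilin (mk g x) (mk g' y) = mk (g * g') (x * g.1 y) := by
  have : mulBilin (mk g x) (mk g' y) = (LinearMap.rTensor _ (LinearMap.mulLeft k x))
    ((MonoidAlgebra.lift k _ _ groupAct (MonoidAlgebra.single g 1))
      (y ⊗ₜ MonoidAlgebra.single g' 1)) := rfl
  rw [this]
  simp only [MonoidAlgebra.lift_single, groupAct]
  simp
  rfl

instance : Mul (SemidirectProduct k H) := ⟨fun x y => mulBilin x y⟩

instance : One (SemidirectProduct k H) := ⟨mk 1 1⟩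

/-- The multiplication rule `(x ⋊ g)(y ⋊ g') = x g(y) ⋊ g g'`. -/
lemma mk_mul_mk (g g' : AntipodeSqGroup k H) (x y : H) :
    mk g x * mk g' y = mk (g * g') (x * g.1 y) := mulBilin_mk g g' x y

/-- The unit is `1 ⋊ id`. -/
lemma one_def : (1 : SemidirectProduct k H) = mk 1 1 := rfl

protected lemma add_mul' (x y z : SemidirectProduct k H) : (x + y) * z = x * z + y * z :=
  LinearMap.map_add₂ mulBilin x y z

protected lemma mul_add' (x y z : SemidirectProduct k H) : x * (y + z) = x * y + x * z :=
  map_add (mulBilin x) y z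

protected lemma zero_mul' (z : SemidirectProduct k H) : 0 * z = 0 :=
  LinearMap.map_zero₂ mulBilin z

protected lemma mul_zero' (z : SemidirectProduct k H) : z * 0 = 0 :=
  map_zero (mulBilin z)

instance instRing : Ring (SemidirectProduct k H) :=
  { (inferInstance : AddCommGroup (SemidirectProduct k H)) with
    mul := (· * ·)
    one := 1
    left_distrib := SemidirectProduct.mul_add'
    right_distrib := SemidirectProduct.add_mul'
    zero_mul := SemidirectProduct.zero_mul'
    mul_zero := SemidirectProduct.mul_zero'
    mul_assoc := fun x y z => by
      induction x using induction with
      | h0 => simp only [SemidirectProduct.zero_mul']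
      | hadd a b ha hb => simp only [SemidirectProduct.add_mul', ha, hb]
      | hmk g x =>
      induction y using induction with
      | h0 => simp only [SemidirectProduct.zero_mul', SemidirectProduct.mul_zero']
      | hadd a b ha hb =>
        simp only [SemidirectProduct.add_mul', SemidirectProduct.mul_add', ha, hb]
      | hmk g' y =>
      induction z using induction with
      | h0 => simp only [SemidirectProduct.mul_zero']
      | hadd a b ha hb => simp only [SemidirectProduct.mul_add', ha, hb]
      | hmk g'' z => simp [mk_mul_mk, mul_assoc]
    one_mul := fun x => by
      induction x using induction with
      | h0 => exact SemidirectProduct.mul_zero' _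
      | hadd a b ha hb => rw [SemidirectProduct.mul_add', ha, hb]
      | hmk g x => simp [one_def, mk_mul_mk]
    mul_one := fun x => by
      induction x using induction with
      | h0 => exact SemidirectProduct.zero_mul' _
      | hadd a b ha hb => rw [SemidirectProduct.add_mul', ha, hb]
      | hmk g x => simp [one_def, mk_mul_mk] }

instance instAlgebra : Algebra k (SemidirectProduct k H) :=
  Algebra.ofModule (fun r x y => LinearMap.map_smul₂ mulBilin r x y)
    (fun r x y => map_smul (mulBilin x) r y)

lemma counit_mk (g : AntipodeSqGroup k H) (x : H) :
    counit (R := k) (mk g x) = counit (R := k) x := by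
  have : counit (R := k) (mk g x) =
    counit (R := k) (MonoidAlgebra.single g (1 : k)) • counit (R := k) x := rfl
  rw [this]; simp

lemma comul_mk (g : AntipodeSqGroup k H) (x : H) :
    comul (R := k) (mk g x) = TensorProduct.map (mk g) (mk g) (comul x) := by
  have : comul (R := k) (mk g x) = AlgebraTensorModule.tensorTensorTensorComm k k k k H H _ _
    (comul x ⊗ₜ comul (R := k) (MonoidAlgebra.single g (1 : k))) := rfl
  rw [this, MonoidAlgebra.comul_single]
  simp only [CommSemiring.comul_apply, map_tmul]
  induction comul (R := k) x with
  | zero => simp only [map_zero, zero_tmul]; rfl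
  | add u v hu hv => simp only [map_add, add_tmul, hu, hv]; rfl
  | tmul u v => rfl

instance instBialgebra : Bialgebra k (SemidirectProduct k H) :=
  Bialgebra.mk' k (SemidirectProduct k H)
    (by rw [one_def]; exact (counit_mk 1 1).trans (Bialgebra.counit_one))
    (fun {a b} => by
      induction a using induction with
      | h0 => simp
      | hadd x y hx hy => simp only [add_mul, map_add, hx, hy]
      | hmk g x =>
      induction b using induction with
      | h0 => simp
      | hadd x y hx hy => simp only [mul_add, map_add, hx, hy]
      | hmk g' y =>
        rw [mk_mul_mk, counit_mk, counit_mk, counit_mk, Bialgebra.counit_mul,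
          (comul_group_counit_group g).2])
    (by
      rw [one_def, comul_mk, Bialgebra.comul_one]
      rfl)
    (fun {a b} => by
      induction a using induction with
      | h0 => simp
      | hadd x y hx hy => simp only [add_mul, map_add, hx, hy]
      | hmk g x =>
      induction b using induction with
      | h0 => simp
      | hadd x y hx hy => simp only [mul_add, map_add, hx, hy]
      | hmk g' y =>
        rw [mk_mul_mk, comul_mk, comul_mk, comul_mk, Bialgebra.comul_mul,
          (comul_group_counit_group g).1]
        induction comul (R := k) x with
        | zero => simp
        | add u v hu hv => simp only [add_mul, map_add, hu, hv]
        | tmul u u' =>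
        induction comul (R := k) y with
        | zero => simp
        | add u v hu hv => simp only [mul_add, map_add, hu, hv]
        | tmul v v' => simp [mk_mul_mk])

/-- The embedding of `k⟨S²⟩`. -/
def inclGroup : MonoidAlgebra k (AntipodeSqGroup k H) →ₗ[k] SemidirectProduct k H :=
  TensorProduct.mk k H (MonoidAlgebra k (AntipodeSqGroup k H)) 1

/-- The antipode: `x ⋊ g ↦ (1 ⋊ g⁻¹)(S(x) ⋊ id) = g⁻¹(S(x)) ⋊ g⁻¹`. -/
def antipodeAux : SemidirectProduct k H →ₗ[k] SemidirectProduct k H :=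
  TensorProduct.lift (((LinearMap.mul k (SemidirectProduct k H)).compl₁₂
    (inclGroup ∘ₗ antipode k) (mk 1 ∘ₗ antipode k)).flip)

lemma antipodeAux_mk (g : AntipodeSqGroup k H) (x : H) :
    antipodeAux (mk g x) = mk g⁻¹ (g⁻¹.1 (antipode k x)) := by
  have : antipodeAux (mk g x) =
    inclGroup (antipode k (MonoidAlgebra.single g (1 : k))) * mk 1 (antipode k x) := rfl
  rw [this, MonoidAlgebra.antipode_single]
  have h : inclGroup (MonoidAlgebra.single g⁻¹ (antipode k (1 : k))) = mk g⁻¹ (1 : H) := by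
    rw [antipode_one]; rfl
  rw [h, mk_mul_mk, mul_one, one_mul]

/-- `H ⋊ k⟨S²⟩` is a Hopf algebra. -/
instance instHopfAlgebra : HopfAlgebra k (SemidirectProduct k H) where
  antipode := antipodeAux
  mul_antipode_rTensor_comul := by
    refine hom_ext fun g x => ?_
    simp only [LinearMap.comp_apply]
    rw [comul_mk, counit_mk]
    have h : ∀ t : H ⊗[k] H, LinearMap.mul' k (SemidirectProduct k H) (antipodeAux.rTensor _
        (TensorProduct.map (mk g) (mk g) t)) =
        mk 1 (g⁻¹.1 (LinearMap.mul' k H ((antipode k).rTensor H t))) := by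
      intro t
      induction t with
      | zero => simp
      | add u v hu hv => simp only [map_add, hu, hv]
      | tmul u v => simp [antipodeAux_mk, mk_mul_mk]
    rw [h, mul_antipode_rTensor_comul_apply]
    simp [Algebra.algebraMap_eq_smul_one, one_def]
  mul_antipode_lTensor_comul := by
    refine hom_ext fun g x => ?_
    simp only [LinearMap.comp_apply]
    rw [comul_mk, counit_mk]
    have h : ∀ t : H ⊗[k] H, LinearMap.mul' k (SemidirectProduct k H) (antipodeAux.lTensor _
        (TensorProduct.map (mk g) (mk g) t)) =
        mk 1 (LinearMap.mul' k H ((antipode k).lTensor H t)) := by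
      intro t
      induction t with
      | zero => simp
      | add u v hu hv => simp only [map_add, hu, hv]
      | tmul u v => simp [antipodeAux_mk, mk_mul_mk]
    rw [h, mul_antipode_lTensor_comul_apply]
    simp [Algebra.algebraMap_eq_smul_one, one_def]

/-- The antipode of `H ⋊ k⟨S²⟩` is `x ⋊ g ↦ g⁻¹(S(x)) ⋊ g⁻¹`. -/
lemma antipode_mk (g : AntipodeSqGroup k H) (x : H) :
    antipode k (mk g x) = mk g⁻¹ (g⁻¹.1 (antipode k x)) := antipodeAux_mk g x

/-- The antipode of `H ⋊ k⟨S²⟩` is bijective. -/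
instance instBijectiveAntipode : BijectiveAntipode k (SemidirectProduct k H) where
  bijective := by
    let e : H ≃ₗ[k] H := LinearEquiv.ofBijective (antipode k) BijectiveAntipode.bijective
    have he : ∀ x, antipode k (e.symm x) = x := e.apply_symm_apply
    have he' : ∀ x, e.symm (antipode k x) = x := e.symm_apply_apply
    let T : SemidirectProduct k H →ₗ[k] SemidirectProduct k H :=
      TensorProduct.lift (((LinearMap.mul k (SemidirectProduct k H)).compl₁₂
        (inclGroup ∘ₗ antipode k) (mk 1)).flip)
    have hT : ∀ (g : AntipodeSqGroup k H) x, T (mk g x) = mk g⁻¹ (g⁻¹.1 x) := by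
      intro g x
      have : T (mk g x) =
        inclGroup (antipode k (MonoidAlgebra.single g (1 : k))) * mk 1 x := rfl
      rw [this, MonoidAlgebra.antipode_single]
      have h : inclGroup (MonoidAlgebra.single g⁻¹ (antipode k (1 : k))) = mk g⁻¹ (1 : H) := by
        rw [antipode_one]; rfl
      rw [h, mk_mul_mk, mul_one, one_mul]
    let E : SemidirectProduct k H →ₗ[k] SemidirectProduct k H :=
      LinearMap.rTensor (MonoidAlgebra k (AntipodeSqGroup k H)) e.symm.toLinearMap
    have hE : ∀ (g : AntipodeSqGroup k H) x, E (mk g x) = mk g (e.symm x) := fun g x => rfl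
    have h1 : (E ∘ₗ T) ∘ₗ antipode k = LinearMap.id :=
      hom_ext fun g x => by simp [antipode_mk, hT, hE, he']
    have h2 : antipode k ∘ₗ (E ∘ₗ T) = LinearMap.id :=
      hom_ext fun g x => by simp [antipode_mk, hT, hE, he]
    exact ⟨Function.LeftInverse.injective (g := E ∘ₗ T) (LinearMap.congr_fun h1),
      Function.RightInverse.surjective (g := E ∘ₗ T) (LinearMap.congr_fun h2)⟩

end

end SemidirectProduct

/-! ### Exponents -/

section Exponent
variable (k H : Type*) [Field k] [Ring H] [HopfAlgebra k H]

/-- The iterated comultiplication `Δₙ : H → H^{⊗ n}`, `h ↦ h₁ ⊗ ⋯ ⊗ hₙ`, given by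
`Δ₀ = ε` and `Δₙ₊₁ = (Δₙ ⊗ id) ∘ Δ` (so that `Δ₁ = id`). -/
def iteratedComul : (n : ℕ) → (H →ₗ[k] ⨂[k]^n H)
  | 0 => (PiTensorProduct.isEmptyEquiv (Fin 0)).symm.toLinearMap ∘ₗ counit
  | n + 1 => (TensorPower.mulEquiv (n := n) (m := 1)).toLinearMap ∘ₗ
      TensorProduct.map (iteratedComul n)
        (PiTensorProduct.subsingletonEquiv (0 : Fin 1)).symm.toLinearMap ∘ₗ comul

/-- The iterated multiplication `mₙ : H^{⊗ n} → H`, `h₁ ⊗ ⋯ ⊗ hₙ ↦ h₁ ⋯ hₙ`. -/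
def iteratedMul (n : ℕ) : ⨂[k]^n H →ₗ[k] H :=
  PiTensorProduct.lift (MultilinearMap.mkPiAlgebraFin k n H)

variable [BijectiveAntipode k H]

/-- The map `mₙ ∘ (id ⊗ S^{2i} ⊗ S^{4i} ⊗ ⋯ ⊗ S^{2(n-1)i}) ∘ Δₙ : H → H`. -/
def twistedPower (i : ℤ) (n : ℕ) : H →ₗ[k] H :=
  iteratedMul k H n ∘ₗ
    PiTensorProduct.map (fun j : Fin n => (antipodeSq k H ^ (i * (j : ℤ))).toLinearMap) ∘ₗ
      iteratedComul k H n

/-- The twisted exponent `exp_{2i}(H)`: the least `n ≥ 1` such that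
`mₙ ∘ (id ⊗ S^{2i} ⊗ ⋯ ⊗ S^{2(n-1)i}) ∘ Δₙ = u ∘ ε`, or `∞` if there is none. -/
def twistedExponent (i : ℤ) : ℕ∞ :=
  sInf ((fun n : ℕ => (n : ℕ∞)) ''
    {n : ℕ | 1 ≤ n ∧ twistedPower k H i n = Algebra.linearMap k H ∘ₗ counit})

/-- The exponent `exp(H)`: the least `n ≥ 1` such that
`mₙ ∘ (id ⊗ S^{-2} ⊗ ⋯ ⊗ S^{-2n+2}) ∘ Δₙ = u ∘ ε`, or `∞` if there is none. -/
def exponent : ℕ∞ :=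
  sInf ((fun n : ℕ => (n : ℕ∞)) ''
    {n : ℕ | 1 ≤ n ∧ iteratedMul k H n ∘ₗ
      PiTensorProduct.map (fun j : Fin n => (antipodeSq k H ^ (-(j : ℤ))).toLinearMap) ∘ₗ
        iteratedComul k H n = Algebra.linearMap k H ∘ₗ counit})

end Exponent

/-- The least common multiple of a family of elements of `{1, 2, 3, …} ∪ {∞}`: the least nonzero
common multiple. Every positive integer divides `∞`, and `∞` divides only `∞` (and `0`), so it is
`∞` as soon as one of the members is. -/
def lcmFamily {ι : Type*} (f : ι → ℕ∞) : ℕ∞ :=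
  sInf {N : ℕ∞ | N ≠ 0 ∧ ∀ i, f i ∣ N}

end HopfExp

end

/-!
# The exponent of `H ⋊ k⟨S²⟩`

Write `Pᵢ(n)` for `HopfExp.twistedPower k H i n`. In the convolution algebra `End(H)` it is the
product `id * σ * ⋯ * σⁿ⁻¹` with `σ = S^{2i}` (`twistedPower_eq`). Since composition with the algebra
map `σᵐ` is multiplicative for convolution, `Pᵢ(m + n) = Pᵢ(m) * (σᵐ ∘ Pᵢ(n))`. This has two
consequences.

* The set of `n` with `Pᵢ(n) = u ∘ ε` is closed under addition and subtraction, hence it consists of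
  the multiples of `exp_{2i}(H)` (`twistedExponent_dvd_iff`).
* If `Pᵢ(n) = u ∘ ε`, then computing `Pᵢ(n + 1)` as `Pᵢ(n) * σⁿ` and as `id * (σ ∘ Pᵢ(n))` gives
  `σⁿ = id` (`antipodeSq_zpow_mul_eq_one`).

In `H ⋊ k⟨S²⟩` the square of the antipode sends `h ⋊ g` to `S²(h) ⋊ g`. Therefore the `n`-th map in
the definition of the exponent sends `h ⋊ S^{2m}` to `Pₘ₋₁(n)(h) ⋊ S^{2mn}`
(`convProd_antipodeSq_mk`). It is `u ∘ ε` if and only if every `Pᵢ(n)` is `u ∘ ε` and `S^{2n} = id`,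
where the last condition is automatic. So the exponent of `H ⋊ k⟨S²⟩` is the least positive common
multiple of the `exp_{2i}(H)`.
-/

noncomputable section

open TensorProduct Coalgebra HopfAlgebra WithConv

namespace HopfExp

/-! ### Iterated operations and convolution products -/

section Convolution
variable {k H : Type*} [Field k] [Ring H] [HopfAlgebra k H]

/-- The convolution product `f₀ * f₁ * ⋯ * fₙ₋₁` of linear endomorphisms; it is `u ∘ ε` for
`n = 0`. -/
def convProd (f : ℕ → (H →ₗ[k] H)) (n : ℕ) : WithConv (H →ₗ[k] H) :=
  ((List.range n).map fun j => toConv (f j)).prod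

lemma convProd_zero (f : ℕ → (H →ₗ[k] H)) : convProd f 0 = 1 := rfl

lemma convProd_succ (f : ℕ → (H →ₗ[k] H)) (n : ℕ) :
    convProd f (n + 1) = convProd f n * toConv (f n) :=
  List.prod_range_succ _ n

lemma convProd_one (f : ℕ → (H →ₗ[k] H)) : convProd f 1 = toConv (f 0) := by
  rw [convProd_succ, convProd_zero, one_mul]

lemma mulEquiv_tprod (n : ℕ) (a : Fin n → H) (x : H) :
    TensorPower.mulEquiv (R := k) (n := n) (m := 1)
      (PiTensorProduct.tprod k a ⊗ₜ (PiTensorProduct.subsingletonEquiv (0 : Fin 1)).symm x) =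
      PiTensorProduct.tprod k (Fin.snoc (α := fun _ => H) a x) := by
  rw [PiTensorProduct.subsingletonEquiv_symm_apply']
  refine (TensorPower.tprod_mul_tprod k a (fun _ : Fin 1 => x)).trans ?_
  exact congrArg _ (Fin.append_right_eq_snoc a fun _ => x)

lemma iteratedMul_map_mulEquiv (f : ℕ → (H →ₗ[k] H)) (n : ℕ) (t : ⨂[k]^n H) (x : H) :
    iteratedMul k H (n + 1) (PiTensorProduct.map (fun j : Fin (n + 1) => f j)
      (TensorPower.mulEquiv (n := n) (m := 1)
        (t ⊗ₜ (PiTensorProduct.subsingletonEquiv (0 : Fin 1)).symm x))) =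
      iteratedMul k H n (PiTensorProduct.map (fun j : Fin n => f j) t) * f n x := by
  induction t using PiTensorProduct.induction_on with
  | smul_tprod r a =>
    rw [← TensorProduct.smul_tmul', map_smul, map_smul, map_smul, map_smul, map_smul, mulEquiv_tprod,
      PiTensorProduct.map_tprod, PiTensorProduct.map_tprod, smul_mul_assoc]
    simp only [iteratedMul, PiTensorProduct.lift.tprod, MultilinearMap.mkPiAlgebraFin_apply,
      List.ofFn_succ', List.concat_eq_append, List.prod_append]
    simp
  | add u v hu hv => simp only [add_tmul, map_add, hu, hv, add_mul]

/-- The map `mₙ ∘ (f₀ ⊗ ⋯ ⊗ fₙ₋₁) ∘ Δₙ` is a convolution product. -/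
lemma iteratedMul_comp_map_comp_iteratedComul (f : ℕ → (H →ₗ[k] H)) (n : ℕ) :
    iteratedMul k H n ∘ₗ PiTensorProduct.map (fun j : Fin n => f j) ∘ₗ iteratedComul k H n =
      (convProd f n).ofConv := by
  induction n with
  | zero =>
    ext x
    simp [iteratedComul, iteratedMul, convProd_zero, PiTensorProduct.isEmptyEquiv,
      LinearMap.convOne_def, Algebra.algebraMap_eq_smul_one]
  | succ n ih =>
    rw [convProd_succ, LinearMap.convMul_def, ← ih]
    have h : iteratedMul k H (n + 1) ∘ₗ PiTensorProduct.map (fun j : Fin (n + 1) => f j) ∘ₗ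
        (TensorPower.mulEquiv (n := n) (m := 1)).toLinearMap ∘ₗ
          TensorProduct.map (iteratedComul k H n)
            (PiTensorProduct.subsingletonEquiv (0 : Fin 1)).symm.toLinearMap =
        LinearMap.mul' k H ∘ₗ TensorProduct.map (iteratedMul k H n ∘ₗ
          PiTensorProduct.map (fun j : Fin n => f j) ∘ₗ iteratedComul k H n) (f n) := by
      ext x y
      exact iteratedMul_map_mulEquiv f n _ y
    ext x
    exact LinearMap.congr_fun h (comul x)

/-- Composition with an algebra map preserves convolution products. -/
lemma comp_convProd (σ : H →ₐ[k] H) (f : ℕ → (H →ₗ[k] H)) (n : ℕ) :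
    toConv (σ.toLinearMap ∘ₗ (convProd f n).ofConv) =
      convProd (fun j => σ.toLinearMap ∘ₗ f j) n := by
  induction n with
  | zero => exact algHom_comp_one σ
  | succ n ih =>
    rw [convProd_succ, convProd_succ, LinearMap.algHom_comp_convMul_distrib, ← ih]

lemma convProd_add (f : ℕ → (H →ₗ[k] H)) (m n : ℕ) :
    convProd f (m + n) = convProd f m * convProd (fun j => f (m + j)) n := by
  induction n with
  | zero => rw [convProd_zero, mul_one, add_zero]
  | succ n ih => rw [← add_assoc, convProd_succ, convProd_succ, ih, mul_assoc]

lemma convProd_apply_one {f : ℕ → (H →ₗ[k] H)} (hf : ∀ j, f j 1 = 1) (n : ℕ) :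
    (convProd f n).ofConv 1 = 1 := by
  induction n with
  | zero => simp [convProd_zero, LinearMap.convOne_def]
  | succ n ih =>
    rw [convProd_succ, LinearMap.convMul_def]
    simp [Bialgebra.comul_one, Algebra.TensorProduct.one_def, ih, hf]

end Convolution

/-! ### Twisted powers -/

section TwistedPower
variable {k H : Type*} [Field k] [Ring H] [HopfAlgebra k H] [BijectiveAntipode k H]

lemma twistedPower_eq (i : ℤ) (n : ℕ) : twistedPower k H i n =
    (convProd (fun j => (antipodeSq k H ^ (i * (j : ℤ))).toLinearMap) n).ofConv :=
  iteratedMul_comp_map_comp_iteratedComul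
    (fun j : ℕ => (antipodeSq k H ^ (i * (j : ℤ))).toLinearMap) n

lemma twistedPower_eq_iff (i : ℤ) (n : ℕ) :
    twistedPower k H i n = Algebra.linearMap k H ∘ₗ counit ↔
      convProd (fun j => (antipodeSq k H ^ (i * (j : ℤ))).toLinearMap) n = 1 := by
  rw [twistedPower_eq, LinearMap.convOne_def, ← WithConv.toConv_injective.eq_iff]

lemma convProd_antipodeSq_zpow_add (i : ℤ) (m n : ℕ) :
    convProd (fun j => (antipodeSq k H ^ (i * (j : ℤ))).toLinearMap) (m + n) =
      convProd (fun j => (antipodeSq k H ^ (i * (j : ℤ))).toLinearMap) m *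
        toConv ((antipodeSq k H ^ (i * (m : ℤ))).toLinearMap ∘ₗ
          (convProd (fun j => (antipodeSq k H ^ (i * (j : ℤ))).toLinearMap) n).ofConv) := by
  have h := comp_convProd (antipodeSq k H ^ (i * (m : ℤ))).toAlgHom
    (fun j => (antipodeSq k H ^ (i * (j : ℤ))).toLinearMap) n
  rw [convProd_add]
  congr 1
  refine Eq.trans ?_ h.symm
  congr 1
  ext j x
  simp [mul_add, zpow_add]

/-- After a trivial twisted power, the twisted powers start again from the beginning. -/
lemma convProd_add_eq_one_iff {i : ℤ} {m : ℕ}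
    (hm : convProd (fun j => (antipodeSq k H ^ (i * (j : ℤ))).toLinearMap) m = 1) (n : ℕ) :
    convProd (fun j => (antipodeSq k H ^ (i * (j : ℤ))).toLinearMap) (m + n) = 1 ↔
      convProd (fun j => (antipodeSq k H ^ (i * (j : ℤ))).toLinearMap) n = 1 := by
  have h1 : toConv ((antipodeSq k H ^ (i * (m : ℤ))).toLinearMap ∘ₗ
      (1 : WithConv (H →ₗ[k] H)).ofConv) = 1 :=
    algHom_comp_one (antipodeSq k H ^ (i * (m : ℤ))).toAlgHom
  rw [convProd_antipodeSq_zpow_add, hm, one_mul]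
  refine ⟨fun h => ?_, fun h => by rw [h, h1]⟩
  rw [← h1] at h
  ext x
  exact (antipodeSq k H ^ (i * (m : ℤ))).injective (LinearMap.congr_fun (congrArg ofConv h) x)

lemma antipodeSq_zpow_mul_eq_one {i : ℤ} {n : ℕ}
    (hn : convProd (fun j => (antipodeSq k H ^ (i * (j : ℤ))).toLinearMap) n = 1) :
    antipodeSq k H ^ (i * (n : ℤ)) = 1 := by
  have h := convProd_antipodeSq_zpow_add (k := k) (H := H) i 1 n
  rw [add_comm, convProd_succ, hn, one_mul, convProd_one] at h
  have h1 : toConv ((antipodeSq k H ^ (i * ((1 : ℕ) : ℤ))).toLinearMap ∘ₗ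
      (1 : WithConv (H →ₗ[k] H)).ofConv) = 1 :=
    algHom_comp_one (antipodeSq k H ^ (i * ((1 : ℕ) : ℤ))).toAlgHom
  rw [h1, mul_one] at h
  ext x
  simpa using LinearMap.congr_fun (congrArg ofConv h) x

lemma twistedExponent_dvd_iff (i : ℤ) {n : ℕ} (hn : n ≠ 0) :
    twistedExponent k H i ∣ (n : ℕ∞) ↔
      twistedPower k H i n = Algebra.linearMap k H ∘ₗ counit := by
  set s : Set ℕ := {n : ℕ | 1 ≤ n ∧ twistedPower k H i n = Algebra.linearMap k H ∘ₗ counit}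
    with hs
  rcases s.eq_empty_or_nonempty with h0 | h0
  · have htop : twistedExponent k H i = ⊤ := by
      rw [twistedExponent, ← hs, h0, Set.image_empty, sInf_empty]
    have hmem : n ∉ s := h0 ▸ Set.notMem_empty n
    rw [htop]
    constructor
    · rintro ⟨c, hc⟩
      rcases eq_or_ne c 0 with rfl | hc0
      · rw [mul_zero] at hc
        exact absurd (by exact_mod_cast hc) hn
      · rw [ENat.top_mul hc0] at hc
        exact absurd hc (ENat.natCast_ne_top n)
    · intro h
      exact absurd ⟨Nat.one_le_iff_ne_zero.2 hn, h⟩ hmem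
  · obtain ⟨hd1, hd⟩ := Nat.sInf_mem h0
    have hval : twistedExponent k H i = ((sInf s : ℕ) : ℕ∞) := by
      refine le_antisymm (sInf_le ⟨_, Nat.sInf_mem h0, rfl⟩) (le_sInf ?_)
      rintro _ ⟨m, hm, rfl⟩
      exact Nat.cast_le.2 (Nat.sInf_le hm)
    set d := sInf s
    rw [twistedPower_eq_iff] at hd
    have hmul : ∀ c r : ℕ,
        convProd (fun j => (antipodeSq k H ^ (i * (j : ℤ))).toLinearMap) (d * c + r) = 1 ↔
          convProd (fun j => (antipodeSq k H ^ (i * (j : ℤ))).toLinearMap) r = 1 := by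
      intro c r
      induction c with
      | zero => rw [mul_zero, zero_add]
      | succ c ih =>
        rw [show d * (c + 1) + r = d + (d * c + r) by ring, convProd_add_eq_one_iff hd, ih]
    have hdvd : twistedExponent k H i ∣ (n : ℕ∞) ↔ d ∣ n := by
      rw [hval]
      constructor
      · rintro ⟨c, hc⟩
        induction c using ENat.recTopCoe with
        | top =>
          rw [ENat.mul_top (by exact_mod_cast (Nat.one_le_iff_ne_zero.1 hd1))] at hc
          exact absurd hc (ENat.natCast_ne_top n)
        | coe c => exact ⟨c, by exact_mod_cast hc⟩
      · rintro ⟨c, hc⟩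
        exact ⟨c, by exact_mod_cast hc⟩
    rw [hdvd, twistedPower_eq_iff]
    constructor
    · rintro ⟨c, rfl⟩
      exact (hmul c 0).2 (convProd_zero _)
    · intro h
      rw [← Nat.div_add_mod n d, hmul] at h
      by_contra hnd
      have hr : 1 ≤ n % d := Nat.one_le_iff_ne_zero.2 fun h' => hnd (Nat.dvd_of_mod_eq_zero h')
      have hle : d ≤ n % d := Nat.sInf_le ⟨hr, (twistedPower_eq_iff i _).2 h⟩
      exact absurd (Nat.mod_lt n hd1) (not_lt.2 hle)

end TwistedPower

/-! ### The antipode square and the exponent of the semidirect product -/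

/-- A map intertwining two algebra automorphisms intertwines their integer powers. -/
lemma map_zpow_apply {k A B : Type*} [Field k] [Ring A] [Ring B] [Algebra k A] [Algebra k B]
    {f : A → B} {a : A ≃ₐ[k] A} {b : B ≃ₐ[k] B} (h : ∀ x, f (a x) = b (f x)) (z : ℤ) (x : A) :
    f ((a ^ z) x) = (b ^ z) (f x) := by
  have hinv : ∀ x, f (a⁻¹ x) = b⁻¹ (f x) := fun x => b.injective <| by
    rw [← h]
    exact (congrArg f (a.apply_symm_apply x)).trans (b.apply_symm_apply (f x)).symm
  induction z generalizing x with
  | zero => simp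
  | succ n ih => rw [zpow_add_one, zpow_add_one, AlgEquiv.mul_apply, AlgEquiv.mul_apply, ih, h]
  | pred n ih => rw [zpow_sub_one, zpow_sub_one, AlgEquiv.mul_apply, AlgEquiv.mul_apply, ih, hinv]

namespace SemidirectProduct
variable {k H : Type*} [Field k] [Ring H] [HopfAlgebra k H] [BijectiveAntipode k H]

lemma mk_one_injective : Function.Injective
    (fun g : AntipodeSqGroup k H => (mk g (1 : H) : SemidirectProduct k H)) := by
  intro g g' h
  let π : H ⊗[k] MonoidAlgebra k (AntipodeSqGroup k H) →ₗ[k]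
      MonoidAlgebra k (AntipodeSqGroup k H) :=
    (TensorProduct.lid k _).toLinearMap ∘ₗ (counit (R := k) (A := H)).rTensor _
  have hπ : ∀ g : AntipodeSqGroup k H, π (mk g (1 : H)) = MonoidAlgebra.single g 1 := by
    intro g
    change π ((1 : H) ⊗ₜ MonoidAlgebra.single g 1) = _
    simp [π]
  have h1 : MonoidAlgebra.single g (1 : k) = MonoidAlgebra.single g' 1 := by
    rw [← hπ, ← hπ]
    exact congrArg π h
  exact MonoidAlgebra.of_injective h1

lemma antipode_group_apply (g : AntipodeSqGroup k H) (x : H) :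
    antipode k (g.1 x) = g.1 (antipode k x) := by
  obtain ⟨_, z, rfl⟩ := g
  exact map_zpow_apply (f := antipode k) (fun _ => rfl) z x

lemma antipodeSq_mk (g : AntipodeSqGroup k H) (x : H) :
    antipodeSq k (SemidirectProduct k H) (mk g x) = mk g (antipodeSq k H x) := by
  rw [antipodeSq_apply, antipode_mk, antipode_mk, antipode_group_apply, inv_inv, antipodeSq_apply]
  congr 1
  exact g.1.apply_symm_apply _

lemma antipodeSq_zpow_mk (g : AntipodeSqGroup k H) (z : ℤ) (x : H) :
    (antipodeSq k (SemidirectProduct k H) ^ z) (mk g x) = mk g ((antipodeSq k H ^ z) x) :=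
  (map_zpow_apply (f := mk g) (fun x => (antipodeSq_mk g x).symm) z x).symm

/-- The `n`-th map in the definition of the exponent sends `x ⋊ S^{2m}` to `P(x) ⋊ S^{2mn}`, where
`P` is the `n`-th power twisted by `S^{2(m-1)}`: moving the group elements to the right twists the
`j`-th factor by `S^{2mj}`, in addition to the `S^{-2j}` of the definition. -/
lemma convProd_antipodeSq_mk {g : AntipodeSqGroup k H} {m : ℤ} (hg : antipodeSq k H ^ m = g.1)
    (n : ℕ) (x : H) :
    (convProd (fun j : ℕ => (antipodeSq k (SemidirectProduct k H) ^ (-(j : ℤ))).toLinearMap)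
      n).ofConv (mk g x) = mk (g ^ n) (twistedPower k H (m - 1) n x) := by
  rw [twistedPower_eq]
  induction n generalizing x with
  | zero =>
    simp [convProd_zero, LinearMap.convOne_def, counit_mk, Algebra.algebraMap_eq_smul_one, one_def]
  | succ n ih =>
    rw [convProd_succ, convProd_succ, LinearMap.convMul_def, LinearMap.convMul_def]
    simp only [LinearMap.comp_apply, comul_mk]
    induction comul (R := k) x with
    | zero => simp only [map_zero]
    | add u v hu hv => simp only [map_add, hu, hv]
    | tmul u v =>
      have hpow : (g ^ n).1 ((antipodeSq k H ^ (-(n : ℤ))) v) =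
          (antipodeSq k H ^ ((m - 1) * (n : ℤ))) v := by
        rw [SubmonoidClass.coe_pow, ← hg, ← AlgEquiv.mul_apply, ← zpow_natCast, ← zpow_mul,
          ← zpow_add]
        congr 2
        ring
      simp only [map_tmul, LinearMap.mul'_apply, ih, AlgEquiv.toLinearMap_apply,
        antipodeSq_zpow_mk, mk_mul_mk, hpow, pow_succ]

/-- The condition defining the exponent of `H ⋊ k⟨S²⟩` is that all twisted powers are trivial. -/
lemma convProd_antipodeSq_eq_one_iff (n : ℕ) :
    convProd (fun j : ℕ => (antipodeSq k (SemidirectProduct k H) ^ (-(j : ℤ))).toLinearMap) n = 1 ↔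
      ∀ i : ℤ, twistedPower k H i n = Algebra.linearMap k H ∘ₗ counit := by
  constructor
  · intro h i
    set g : AntipodeSqGroup k H := ⟨antipodeSq k H ^ (i + 1), i + 1, rfl⟩
    have key : ∀ x, mk (g ^ n) (twistedPower k H i n x) =
        (counit (R := k) x) • (1 : SemidirectProduct k H) := by
      intro x
      have := convProd_antipodeSq_mk (g := g) (m := i + 1) rfl n x
      rw [add_sub_cancel_right] at this
      rw [← this, h]
      simp [LinearMap.convOne_def, counit_mk, Algebra.algebraMap_eq_smul_one]
    -- Evaluation at `1` shows that `gⁿ = 1`.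
    have hgn : g ^ n = 1 := by
      refine mk_one_injective ?_
      have h1 : twistedPower k H i n 1 = 1 := by
        rw [twistedPower_eq]
        exact convProd_apply_one (fun j => map_one (antipodeSq k H ^ (i * (j : ℤ)))) n
      have := key 1
      rw [h1, Bialgebra.counit_one, one_smul, one_def] at this
      exact this
    let ρ : H ⊗[k] MonoidAlgebra k (AntipodeSqGroup k H) →ₗ[k] H :=
      (TensorProduct.rid k H).toLinearMap ∘ₗ
        (counit (R := k) (A := MonoidAlgebra k (AntipodeSqGroup k H))).lTensor H
    have hρ : ∀ y : H, ρ (mk 1 y) = y := by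
      intro y
      change ρ (y ⊗ₜ MonoidAlgebra.single 1 1) = y
      simp [ρ]
    ext x
    have := key x
    rw [hgn, one_def, ← map_smul] at this
    have h2 := congrArg ρ this
    rw [hρ, hρ] at h2
    rw [h2, LinearMap.comp_apply, Algebra.linearMap_apply, Algebra.algebraMap_eq_smul_one]
  · intro h
    have hn : antipodeSq k H ^ n = 1 := by
      have := antipodeSq_zpow_mul_eq_one ((twistedPower_eq_iff 1 n).1 (h 1))
      rwa [one_mul, zpow_natCast] at this
    apply WithConv.ofConv_injective
    refine hom_ext fun g x => ?_
    obtain ⟨m, hm⟩ := g.2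
    have hgn : g ^ n = 1 := by
      apply Subtype.ext
      rw [SubmonoidClass.coe_pow, ← hm]
      change ((antipodeSq k H ^ m) ^ n) = 1
      rw [← zpow_natCast, ← zpow_mul, mul_comm, zpow_mul, zpow_natCast, hn, one_zpow]
    rw [convProd_antipodeSq_mk hm, h, hgn]
    simp [LinearMap.convOne_def, counit_mk, Algebra.algebraMap_eq_smul_one, one_def]

end SemidirectProduct

end HopfExp

end

/-- For a finite-dimensional Hopf algebra `H` over a field `k`, the exponent of `H ⋊ k⟨S²⟩` is the
least common multiple of the twisted exponents `exp_{2i}(H)`, `i ∈ ℤ` (finite or infinite). -/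
theorem proposition25 {k H : Type*} [Field k] [Ring H] [HopfAlgebra k H] [FiniteDimensional k H] :
    HopfExp.exponent k (HopfExp.SemidirectProduct k H) =
      HopfExp.lcmFamily (fun i : ℤ => HopfExp.twistedExponent k H i) := by
  have hiff : ∀ n : ℕ, n ≠ 0 →
      (HopfExp.iteratedMul k (HopfExp.SemidirectProduct k H) n ∘ₗ
        PiTensorProduct.map (fun j : Fin n =>
          (HopfExp.antipodeSq k (HopfExp.SemidirectProduct k H) ^ (-(j : ℤ))).toLinearMap) ∘ₗ
        HopfExp.iteratedComul k (HopfExp.SemidirectProduct k H) n =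
        Algebra.linearMap k (HopfExp.SemidirectProduct k H) ∘ₗ Coalgebra.counit ↔
      ∀ i : ℤ, HopfExp.twistedExponent k H i ∣ (n : ℕ∞)) := by
    intro n hn
    simp only [HopfExp.twistedExponent_dvd_iff _ hn]
    rw [← HopfExp.SemidirectProduct.convProd_antipodeSq_eq_one_iff,
      HopfExp.iteratedMul_comp_map_comp_iteratedComul (fun j : ℕ =>
        (HopfExp.antipodeSq k (HopfExp.SemidirectProduct k H) ^ (-(j : ℤ))).toLinearMap) n,
      LinearMap.convOne_def, ← WithConv.toConv_injective.eq_iff]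
  refine le_antisymm (le_sInf ?_) (le_sInf ?_)
  · rintro N ⟨hN, hdvd⟩
    induction N using ENat.recTopCoe with
    | top => exact le_top
    | coe n =>
      have hn : n ≠ 0 := by exact_mod_cast hN
      exact sInf_le ⟨n, ⟨Nat.one_le_iff_ne_zero.2 hn, (hiff n hn).2 hdvd⟩, rfl⟩
  · rintro _ ⟨n, ⟨hn, h⟩, rfl⟩
    have hn0 : n ≠ 0 := Nat.one_le_iff_ne_zero.1 hn
    exact sInf_le ⟨Nat.cast_ne_zero.2 hn0, (hiff n hn0).1 h⟩
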